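/- **Theorem.** Let $X$ be a Banach space and let $A:\mathcal D(A)\subset X\to X$ be the infinitesimal generator of a $C_0$-semigroup $T(t)$, $t\ge 0$, with $\|T(t)\|\le Ke^{\alpha t}$ for all $t\ge 0$, where $K\ge 1$ and $\alpha\in\mathbb R$. Let $B:\mathbb R\to L(X)$ be continuous in the operator norm and such that, for each $t\in\mathbb R$, $B(t)$ maps $X$ into $\mathcal D(A)$, $AB(t)$ is a bounded operator, and $B(t)A$ extends from $\mathcal D(A)$ to a bounded operator on $X$. Let $h,M,\delta$ be positive numbers and put $C_t(u)=\int_t^u B(\tau)\,d\tau$. Suppose that for all $t,u\in\mathbb R$ with $|u-t|\le h$ the operator $C_t(u)$ maps $X$ into $\mathcal D(A)$, $C_t(u)A$ extends to a bounded operator on $X$, and $$\|C_t(u)\|\le\delta,\qquad \|C_t(u)B(u)\|\le M\delta,\qquad \|C_t(u)A\|\le M\delta,\qquad \|AC_t(u)\|\le M\delta .$$ A solution on $[s,\infty)$ of $$\dot y=Ay+B(t)y \qquad (*)$$ is understood in the mild sense: a continuous $y:[s,\infty)\to X$ such that, for all $t\ge s$, $\int_s^t y(r)\,dr\in\mathcal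 D(A)$ and $y(t)=y(s)+A\int_s^t y(r)\,dr+\int_s^t B(r)y(r)\,dr$. The evolution operator of $(*)$ is the family $S(t,s)\in L(X)$, $t\ge s$, with $S(s,s)=I$, $S(t,r)S(r,s)=S(t,s)$ for $t\ge r\ge s$, $(t,s)\mapsto S(t,s)x$ continuous for each $x\in X$, and $t\mapsto S(t,s)x$ a solution of $(*)$ on $[s,\infty)$ for all $s\in\mathbb R$, $x\in X$. Then $(*)$ has a unique evolution operator $S(t,s)$, and $$\|S(t,s)\|\le(1+\delta)K e^{\beta(t-s)}\quad\text{for all } t\ge s,\qquad\text{where } \beta=\alpha+3MK\delta+\frac{\log((1+\delta)K)}{h}.$$ If $\beta<0$, then $(*)$ is asymptotically stable: for every $s\in\mathbb R$ and $\varepsilon>0$ there is $\eta>0$ such that every solution $y$ on $[s,\infty)$ with $\|y(s)\|<\eta$ satisfies $\|y(t)\|<\varepsilon$ for all $t\ge s$, and every solution on $[s,\infty)$ tends to $0$ as $t\to\infty$. -/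

import Mathlib

open Set Filter Topology

noncomputable section

namespace EvolutionStability

section Defs

variable {𝕜 X : Type*} [RCLike 𝕜] [NormedAddCommGroup X] [NormedSpace 𝕜 X] [NormedSpace ℝ X]
  [IsScalarTower ℝ 𝕜 X]

/-- `T` is a `C₀`-semigroup of bounded operators on `X` (only times `t ≥ 0` matter). -/
structure IsC0Semigroup (T : ℝ → X →L[𝕜] X) : Prop where
  zero : T 0 = ContinuousLinearMap.id 𝕜 X
  add : ∀ s t : ℝ, 0 ≤ s → 0 ≤ t → T (s + t) = (T s).comp (T t)
  tendsto_zero : ∀ x : X, Tendsto (fun t => T t x) (𝓝[>] 0) (𝓝 x)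

/-- `A` (with its domain) is the infinitesimal generator of `T`: `x ∈ D(A)` and `A x = y` if and
only if `(T(r) x - x) / r → y` as `r ↓ 0`. -/
def IsGenerator (A : X →ₗ.[𝕜] X) (T : ℝ → X →L[𝕜] X) : Prop :=
  ∀ x y : X, (x, y) ∈ A.graph ↔ Tendsto (fun r : ℝ => r⁻¹ • (T r x - x)) (𝓝[>] 0) (𝓝 y)

/-- `D` is the operator `A C`: `C` maps `X` into `D(A)` and `A (C x) = D x` for all `x`. -/
def IsLeftProduct (A : X →ₗ.[𝕜] X) (C D : X →L[𝕜] X) : Prop :=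
  ∀ x : X, (C x, D x) ∈ A.graph

/-- `E` is a bounded extension to all of `X` of the operator `C A`, which is defined on `D(A)`. -/
def IsRightProduct (A : X →ₗ.[𝕜] X) (C E : X →L[𝕜] X) : Prop :=
  ∀ x : A.domain, E x = C (A x)

/-- `C_t(u) = ∫_t^u B(τ) dτ`, an integral in the Banach space of bounded operators. -/
def primitive (B : ℝ → X →L[𝕜] X) (t u : ℝ) : X →L[𝕜] X :=
  ∫ τ in t..u, B τ

/-- `y` is a (mild) solution of `y' = A y + B(t) y` on `[s, ∞)`: it is continuous there, and for
every `t ≥ s` one has `∫_s^t y ∈ D(A)` and `y(t) = y(s) + A ∫_s^t y(r) dr + ∫_s^t B(r) y(r) dr`. -/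
def IsSolution (A : X →ₗ.[𝕜] X) (B : ℝ → X →L[𝕜] X) (s : ℝ) (y : ℝ → X) : Prop :=
  ContinuousOn y (Ici s) ∧
    ∀ t, s ≤ t → (∫ r in s..t, y r, y t - y s - ∫ r in s..t, B r (y r)) ∈ A.graph

/-- `S(t, s)`, `t ≥ s`, is the evolution operator of `y' = A y + B(t) y`: a strongly continuous
evolution family whose orbits `t ↦ S(t, s) x` solve the equation (`S(t, s)` is irrelevant for
`t < s`). -/
structure IsEvolutionOperator (A : X →ₗ.[𝕜] X) (B : ℝ → X →L[𝕜] X)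
    (S : ℝ → ℝ → X →L[𝕜] X) : Prop where
  self : ∀ s, S s s = ContinuousLinearMap.id 𝕜 X
  comp : ∀ s r t, s ≤ r → r ≤ t → (S t r).comp (S r s) = S t s
  continuousOn : ∀ x : X, ContinuousOn (fun p : ℝ × ℝ => S p.1 p.2 x) {p | p.2 ≤ p.1}
  isSolution : ∀ (s : ℝ) (x : X), IsSolution A B s (fun t => S t s x)

/-- Asymptotic stability (of the zero solution) of `y' = A y + B(t) y`: it is stable in the sense
of Lyapunov, and, the equation being linear, every solution tends to zero. -/
def AsymptoticallyStable (A : X →ₗ.[𝕜] X) (B : ℝ → X →L[𝕜] X) : Prop :=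
  (∀ s : ℝ, ∀ ε > 0, ∃ η > 0, ∀ y : ℝ → X, IsSolution A B s y → ‖y s‖ < η →
      ∀ t, s ≤ t → ‖y t‖ < ε) ∧
    ∀ (s : ℝ) (y : ℝ → X), IsSolution A B s y → Tendsto y atTop (𝓝 0)

end Defs

end EvolutionStability

end

open EvolutionStability

/-! The bound rests on an integration by parts that replaces the possibly large `B` by its small
primitive. For a solution `y` on `[s, ∞)` and a final time `t`, consider `φ(ρ) = T(t - ρ)(I -
C_t(ρ)) y(ρ)`. Since `C_t(t) = 0`, `φ(t) = y(t)`, while `φ(s)` costs a factor `(1 + δ) K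
e^{α(t-s)}`. In the derivative the two terms `B y` cancel, leaving `T(t - ρ)(A C - C A - C B) y(ρ)`,
three operators of norm at most `M δ`. Grönwall then gives the rate `α + 3MKδ` on intervals of
length at most `h` (`IsSolution.norm_le_of_sub_le`). Each further interval of length `h` costs
another factor `(1 + δ) K`, which is the logarithmic term of `β` (`IsSolution.norm_le_of_step`).

Mild solutions need not take values in `D(A)`, so `φ` is differentiated only from the right, through
Duhamel's formula and the boundedness of `C A` and `A C`.

Existence comes from the Dyson series. By linearity the growth bound applies to differences of
solutions, which gives uniqueness and hence the linearity and composition law of the solution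
operators. -/

noncomputable section

namespace EvolutionStability

/-! ### Grönwall's inequality. -/

section Gronwall

/-- The integral form of Grönwall's inequality for continuous functions. -/
theorem le_mul_exp_of_le_add_mul_integral {v : ℝ → ℝ} {a c s t : ℝ} (hv : Continuous v)
    (hv0 : ∀ r, 0 ≤ v r) (hc : 0 ≤ c) (ha : 0 ≤ a) (hst : s ≤ t)
    (hle : ∀ r ∈ Icc s t, v r ≤ a + c * ∫ σ in s..r, v σ) :
    v t ≤ a * Real.exp (c * (t - s)) := by
  have hd : ∀ r, HasDerivAt (fun r => a + c * ∫ σ in s..r, v σ) (c * v r) r := fun r =>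
    ((hv.integral_hasStrictDerivAt s r).hasDerivAt.const_mul c).const_add a
  have hV := norm_le_gronwallBound_of_norm_deriv_right_le (δ := a) (K := c) (ε := 0) (a := s)
    (b := t) (fun r _ => (hd r).continuousAt.continuousWithinAt)
    (fun r _ => (hd r).hasDerivWithinAt) (by simp [abs_of_nonneg ha])
    (fun r hr => by
      have h1 := hle r ⟨hr.1, hr.2.le⟩
      rw [Real.norm_of_nonneg (mul_nonneg hc (hv0 r)),
        Real.norm_of_nonneg ((hv0 r).trans h1), add_zero]
      exact mul_le_mul_of_nonneg_left h1 hc) t ⟨hst, le_rfl⟩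
  rw [gronwallBound_ε0] at hV
  exact (hle t ⟨hst, le_rfl⟩).trans ((Real.le_norm_self _).trans hV)

end Gronwall

/-! ### Joint continuity of the semigroup and differentiation of `T(t - ρ) z(ρ)`. -/

section Semigroup

variable {𝕜 X : Type*} [RCLike 𝕜] [NormedAddCommGroup X] [NormedSpace 𝕜 X]

/-- Factoring out `T (min a b)` reduces continuity at `a` to right continuity at `0`. The absolute
value of `α` makes the bound at `min a b` at most the one at `a`. -/
theorem IsC0Semigroup.norm_sub_apply_le {T : ℝ → X →L[𝕜] X} (hT : IsC0Semigroup T) {K α : ℝ}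
    (hK : 0 ≤ K) (hTK : ∀ t, 0 ≤ t → ‖T t‖ ≤ K * Real.exp (α * t)) {a b : ℝ} (ha : 0 ≤ a)
    (hb : 0 ≤ b) (x : X) :
    ‖T b x - T a x‖ ≤ K * Real.exp (|α| * a) * ‖T |b - a| x - x‖ := by
  have hexp : ∀ c, 0 ≤ c → c ≤ a → ‖T c‖ ≤ K * Real.exp (|α| * a) := fun c hc hca =>
    (hTK c hc).trans (mul_le_mul_of_nonneg_left (Real.exp_le_exp.2
      ((mul_le_mul_of_nonneg_right (le_abs_self α) hc).trans
        (mul_le_mul_of_nonneg_left hca (abs_nonneg α)))) hK)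
  rcases le_total a b with hab | hab
  · have h1 : T b x = T a (T (b - a) x) := by
      rw [← ContinuousLinearMap.comp_apply, ← hT.add _ _ ha (sub_nonneg.2 hab)]; simp
    rw [abs_of_nonneg (sub_nonneg.2 hab), h1, ← map_sub]
    exact (T a).le_of_opNorm_le (hexp a ha le_rfl) _
  · have h1 : T a x = T b (T (a - b) x) := by
      rw [← ContinuousLinearMap.comp_apply, ← hT.add _ _ hb (sub_nonneg.2 hab)]; simp
    rw [abs_sub_comm, abs_of_nonneg (sub_nonneg.2 hab), h1, ← map_sub, norm_sub_rev (T _ x) x]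
    exact (T b).le_of_opNorm_le (hexp b hb hab) _

/-- The action of a `C₀`-semigroup, extended by the identity to negative times, is jointly
continuous. -/
theorem IsC0Semigroup.continuous_action {T : ℝ → X →L[𝕜] X} (hT : IsC0Semigroup T) {K α : ℝ}
    (hK : 0 ≤ K) (hTK : ∀ t, 0 ≤ t → ‖T t‖ ≤ K * Real.exp (α * t)) :
    Continuous fun p : ℝ × X => T (max p.1 0) p.2 := by
  have h0 : ∀ x : X, Tendsto (fun t => T t x) (𝓝[≥] 0) (𝓝 x) := fun x => by
    rw [← Ioi_insert, nhdsWithin_insert, tendsto_sup]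
    refine ⟨?_, hT.tendsto_zero x⟩
    have : T 0 x = x := by simp [hT.zero]
    conv => arg 3; rw [← this]
    exact tendsto_pure_nhds _ _
  rw [continuous_iff_continuousAt]
  rintro ⟨τ, x⟩
  rw [ContinuousAt, tendsto_iff_norm_sub_tendsto_zero]
  have hg : Tendsto (fun p : ℝ × X => K * Real.exp (α * max p.1 0) * ‖p.2 - x‖
      + K * Real.exp (|α| * max τ 0) * ‖T |max p.1 0 - max τ 0| x - x‖) (𝓝 (τ, x)) (𝓝 0) := by
    have e1 : Tendsto (fun p : ℝ × X => K * Real.exp (α * max p.1 0) * ‖p.2 - x‖)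
        (𝓝 (τ, x)) (𝓝 0) := by
      have : Continuous (fun p : ℝ × X => K * Real.exp (α * max p.1 0) * ‖p.2 - x‖) := by fun_prop
      simpa using this.tendsto (τ, x)
    have e2 : Tendsto (fun p : ℝ × X => |max p.1 0 - max τ 0|) (𝓝 (τ, x)) (𝓝[≥] 0) := by
      refine tendsto_nhdsWithin_iff.2 ⟨?_, Eventually.of_forall fun _ => mem_Ici.2 (abs_nonneg _)⟩
      have : Continuous (fun p : ℝ × X => |max p.1 0 - max τ 0|) := by fun_prop
      simpa using this.tendsto (τ, x)
    have e3 := ((((h0 x).comp e2).sub_const x).norm).const_mul (K * Real.exp (|α| * max τ 0))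
    simpa using e1.add e3
  refine squeeze_zero (fun _ => norm_nonneg _) (fun p => ?_) hg
  have : T (max p.1 0) p.2 - T (max τ 0) x
      = T (max p.1 0) (p.2 - x) + (T (max p.1 0) x - T (max τ 0) x) := by
    rw [map_sub]; abel
  dsimp only
  rw [this]
  exact (norm_add_le _ _).trans (add_le_add
    ((T _).le_of_opNorm_le (hTK _ (le_max_right _ _)) _)
    (hT.norm_sub_apply_le hK hTK (le_max_right _ _) (le_max_right _ _) x))

theorem IsC0Semigroup.apply_max_add {T : ℝ → X →L[𝕜] X} (hT : IsC0Semigroup T) {a b : ℝ}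
    (ha : 0 ≤ a) (hb : 0 ≤ b) (x : X) : T (max (a + b) 0) x = T a (T (max b 0) x) := by
  rw [max_eq_left (add_nonneg ha hb), max_eq_left hb, hT.add a b ha hb]; rfl

variable [NormedSpace ℝ X] [IsScalarTower ℝ 𝕜 X]

/-- The right derivative of `ρ ↦ T(t - ρ) z(ρ)` when `z(r)` lies in the domain of the generator. -/
theorem IsGenerator.hasDerivWithinAt_semigroup_apply {T : ℝ → X →L[𝕜] X} (hT : IsC0Semigroup T)
    (hJ : Continuous fun p : ℝ × X => T (max p.1 0) p.2) {A : X →ₗ.[𝕜] X} (hA : IsGenerator A T)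
    {z : ℝ → X} {z' a : X} {r t : ℝ} (hrt : r < t) (hz : HasDerivWithinAt z z' (Ici r) r)
    (ha : (z r, a) ∈ A.graph) :
    HasDerivWithinAt (fun ρ => T (max (t - ρ) 0) (z ρ)) (T (max (t - r) 0) (z' - a)) (Ici r) r := by
  rw [← hasDerivWithinAt_Ioi_iff_Ici, hasDerivWithinAt_iff_tendsto_slope' self_notMem_Ioi] at hz ⊢
  have hshift : Tendsto (fun ρ => ρ - r) (𝓝[>] r) (𝓝[>] 0) := by
    refine tendsto_nhdsWithin_iff.2 ⟨?_, ?_⟩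
    · have : Tendsto (fun ρ => ρ - r) (𝓝 r) (𝓝 (r - r)) := by
        exact (continuous_id.sub continuous_const).tendsto r
      rw [sub_self] at this
      exact this.mono_left nhdsWithin_le_nhds
    · filter_upwards [self_mem_nhdsWithin] with ρ hρ using mem_Ioi.2 (sub_pos.2 (mem_Ioi.1 hρ))
  have ha' := ((hA _ _).1 ha).comp hshift
  have ht : Tendsto (fun ρ => t - ρ) (𝓝[>] r) (𝓝 (t - r)) :=
    ((continuous_const.sub continuous_id).tendsto r).mono_left nhdsWithin_le_nhds
  -- The difference quotient is `T (t - ρ)` applied to the slope of `z` minus the generator quotient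
  -- of the fixed vector `z r` at time `ρ - r`. Hence only `z r`, not nearby values, must lie in the
  -- domain.
  have hlim := (hJ.tendsto (t - r, z' - a)).comp (ht.prodMk_nhds (hz.sub ha'))
  refine hlim.congr' ?_
  filter_upwards [self_mem_nhdsWithin, mem_nhdsWithin_of_mem_nhds (Iio_mem_nhds hrt)] with ρ hρ hρt
  have e : T (max (t - r) 0) (z r) = T (max (t - ρ) 0) (T (ρ - r) (z r)) := by
    have h1 : 0 ≤ t - ρ := sub_nonneg.2 (le_of_lt hρt)
    have h2 : 0 ≤ ρ - r := sub_nonneg.2 (le_of_lt hρ)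
    have := hT.apply_max_add h1 h2 (z r)
    rw [max_eq_left h2] at this
    rw [max_eq_left h1, ← this]; congr 3; ring
  simp only [Function.comp_apply, slope_def_module]
  rw [e, ← smul_sub, ← map_sub, ← (T (max (t - ρ) 0)).map_smul_of_tower]
  congr 2
  abel

end Semigroup

/-! ### Duhamel's formula and the inhomogeneous equation. -/

section Duhamel

variable {𝕜 X : Type*} [RCLike 𝕜] [NormedAddCommGroup X] [NormedSpace 𝕜 X]

theorem continuous_convolution {T : ℝ → X →L[𝕜] X} {f : ℝ → X}
    (hJ : Continuous fun p : ℝ × X => T (max p.1 0) p.2)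
    (hf : Continuous f) : Continuous fun p : ℝ × ℝ => T (max (p.1 - p.2) 0) (f p.2) :=
  hJ.comp ((continuous_fst.sub continuous_snd).prodMk (hf.comp continuous_snd))

variable [NormedSpace ℝ X]

/-- Duhamel's formula `T(t - s) x + ∫_s^t T(t - r) f(r) dr`. -/
def duhamel (T : ℝ → X →L[𝕜] X) (s : ℝ) (x : X) (f : ℝ → X) (t : ℝ) : X :=
  T (max (t - s) 0) x + ∫ r in s..t, T (max (t - r) 0) (f r)

variable {T : ℝ → X →L[𝕜] X} {f : ℝ → X}

theorem duhamel_self (hT : IsC0Semigroup T) (s : ℝ) (x : X) (f : ℝ → X) :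
    duhamel T s x f s = x := by
  simp [duhamel, hT.zero]

theorem continuous_duhamel (hJ : Continuous fun p : ℝ × X => T (max p.1 0) p.2)
    (hf : Continuous f) (s : ℝ) (x : X) : Continuous (duhamel T s x f) := by
  refine Continuous.add
    (hJ.comp ((continuous_id.sub continuous_const).prodMk continuous_const)) ?_
  exact intervalIntegral.continuous_parametric_intervalIntegral_of_continuous
    (f := fun t r => T (max (t - r) 0) (f r)) (continuous_convolution hJ hf) continuous_id

/-- If `r + ε` is a fixed final time, `r` survives on the right only as the upper limit of the
integral, so the expression can be differentiated in `r` without any domain condition. -/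
theorem semigroup_apply_duhamel [CompleteSpace X] (hT : IsC0Semigroup T)
    (hJ : Continuous fun p : ℝ × X => T (max p.1 0) p.2) (hf : Continuous f) {s r ε : ℝ} (x : X)
    (hsr : s ≤ r) (hε : 0 ≤ ε) :
    T ε (duhamel T s x f r)
      = T (max (r + ε - s) 0) x + ∫ σ in s..r, T (max (r + ε - σ) 0) (f σ) := by
  have hc : Continuous fun σ => T (max (r - σ) 0) (f σ) :=
    (continuous_convolution hJ hf).comp (continuous_const.prodMk continuous_id)
  rw [duhamel, map_add, ← ContinuousLinearMap.intervalIntegral_comp_comm _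
    (hc.intervalIntegrable s r), ← hT.apply_max_add hε (sub_nonneg.2 hsr)]
  congr 1
  · congr 3; ring
  · refine intervalIntegral.integral_congr fun σ hσ => ?_
    rw [uIcc_of_le hsr] at hσ
    rw [← hT.apply_max_add hε (sub_nonneg.2 hσ.2)]
    congr 3; ring

/-- Rescaling the new piece of the integral to `[0, 1]` exhibits it as `ε` times a function that is
jointly continuous in `ε` and `r` up to `ε = 0`, where it equals `f r`. -/
theorem duhamel_add [CompleteSpace X] (hT : IsC0Semigroup T)
    (hJ : Continuous fun p : ℝ × X => T (max p.1 0) p.2) (hf : Continuous f) {s r ε : ℝ} (x : X)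
    (hsr : s ≤ r) (hε : 0 ≤ ε) :
    duhamel T s x f (r + ε) = T ε (duhamel T s x f r)
      + ε • ∫ θ in (0 : ℝ)..1, T (max (ε * (1 - θ)) 0) (f (r + ε * θ)) := by
  have hc : Continuous fun σ => T (max (r + ε - σ) 0) (f σ) :=
    (continuous_convolution hJ hf).comp (continuous_const.prodMk continuous_id)
  have hsub := intervalIntegral.smul_integral_comp_add_mul (a := 0) (b := 1)
    (fun σ => T (max (r + ε - σ) 0) (f σ)) ε r
  rw [mul_zero, add_zero, mul_one] at hsub
  have hcongr : ∀ θ : ℝ, r + ε - (r + ε * θ) = ε * (1 - θ) := fun θ => by ring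
  simp only [hcongr] at hsub
  rw [semigroup_apply_duhamel hT hJ hf x hsr hε, hsub, duhamel, add_assoc,
    intervalIntegral.integral_add_adjacent_intervals (hc.intervalIntegrable _ _)
      (hc.intervalIntegrable _ _)]

/-- Duhamel's formula solves the inhomogeneous equation `w' = A w + f` in the integrated sense. -/
theorem duhamel_mem_graph [CompleteSpace X] (hT : IsC0Semigroup T)
    (hJ : Continuous fun p : ℝ × X => T (max p.1 0) p.2) {A : X →ₗ.[𝕜] X} (hA : IsGenerator A T)
    (hf : Continuous f) {s t : ℝ} (x : X) (hst : s ≤ t) :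
    (∫ r in s..t, duhamel T s x f r, duhamel T s x f t - x - ∫ r in s..t, f r) ∈ A.graph := by
  set w := duhamel T s x f with hw
  have hwc : Continuous w := continuous_duhamel hJ hf s x
  let H : ℝ → ℝ → X := fun ε r => ∫ θ in (0 : ℝ)..1, T (max (ε * (1 - θ)) 0) (f (r + ε * θ))
  have hH : Continuous (Function.uncurry H) := by
    refine intervalIntegral.continuous_parametric_intervalIntegral_of_continuous'
      (f := fun (p : ℝ × ℝ) θ => T (max (p.1 * (1 - θ)) 0) (f (p.2 + p.1 * θ))) ?_ 0 1
    have : Continuous fun q : (ℝ × ℝ) × ℝ => (q.1.1 * (1 - q.2), f (q.1.2 + q.1.1 * q.2)) := by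
      fun_prop
    exact hJ.comp this
  have hHr : ∀ ε, Continuous (H ε) := fun ε => hH.comp (continuous_const.prodMk continuous_id)
  have hH0 : ∀ r, H 0 r = f r := fun r => by simp [H, hT.zero]
  have hHint : Tendsto (fun ε => ∫ r in s..t, H ε r) (𝓝[>] 0) (𝓝 (∫ r in s..t, f r)) := by
    have := (intervalIntegral.continuous_parametric_intervalIntegral_of_continuous'
      (μ := MeasureTheory.volume) hH s t).tendsto 0
    simp only [hH0] at this
    exact this.mono_left nhdsWithin_le_nhds
  have hW : ∀ u, Tendsto (fun ε : ℝ => ε⁻¹ • ((∫ r in s..(u + ε), w r) - ∫ r in s..u, w r))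
      (𝓝[>] 0) (𝓝 (w u)) := fun u =>
    (hwc.integral_hasStrictDerivAt s u).hasDerivAt.tendsto_slope_zero_right
  have hws : w s = x := duhamel_self hT s x f
  rw [hA]
  have hlim := ((hW t).sub (hW s)).sub hHint
  rw [hws] at hlim
  refine hlim.congr' ?_
  filter_upwards [self_mem_nhdsWithin] with ε hε
  have hε : 0 < ε := hε
  -- Up to the forcing term, `T ε` shifts the window of integration by `ε`. In the generator
  -- quotient only the two end pieces remain, and these tend to `w t` and `w s`.
  have h1 : T ε (∫ r in s..t, w r)
      = (∫ r in s..(t + ε), w r) - (∫ r in s..(s + ε), w r) - ε • ∫ r in s..t, H ε r := by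
    rw [← ContinuousLinearMap.intervalIntegral_comp_comm _ (hwc.intervalIntegrable s t),
      intervalIntegral.integral_interval_sub_left (hwc.intervalIntegrable _ _)
        (hwc.intervalIntegrable _ _), ← intervalIntegral.integral_comp_add_right,
      ← intervalIntegral.integral_smul, ← intervalIntegral.integral_sub
        (by exact (hwc.comp (continuous_add_const ε)).intervalIntegrable _ _)
        (by exact ((hHr ε).const_smul ε).intervalIntegrable _ _)]
    refine intervalIntegral.integral_congr fun r hr => ?_
    rw [uIcc_of_le hst] at hr
    exact eq_sub_of_add_eq (duhamel_add hT hJ hf x hr.1 hε.le).symm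
  rw [h1, intervalIntegral.integral_same, sub_zero]
  simp only [smul_sub, smul_smul, inv_mul_cancel₀ hε.ne', one_smul]
  abel

variable [IsScalarTower ℝ 𝕜 X]

/-- Uniqueness for the integrated form of `w' = A w`, `w(s) = 0`. -/
theorem eq_zero_of_integral_mem_graph [CompleteSpace X] (hT : IsC0Semigroup T)
    (hJ : Continuous fun p : ℝ × X => T (max p.1 0) p.2) {A : X →ₗ.[𝕜] X} (hA : IsGenerator A T)
    {d : ℝ → X} (hd : Continuous d) {s : ℝ}
    (hg : ∀ t, s ≤ t → (∫ r in s..t, d r, d t) ∈ A.graph) {t : ℝ} (hst : s ≤ t) : d t = 0 := by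
  have hder : ∀ u, HasDerivAt (fun u => ∫ r in s..u, d r) (d u) u := fun u =>
    (hd.integral_hasStrictDerivAt s u).hasDerivAt
  have hD : ∀ u, s ≤ u → ∫ r in s..u, d r = 0 := fun u hu => by
    have hcont : Continuous fun ρ => T (max (u - ρ) 0) (∫ r in s..ρ, d r) :=
      hJ.comp ((continuous_const.sub continuous_id).prodMk
        (continuous_iff_continuousAt.2 fun ρ => (hder ρ).continuousAt))
    -- The right derivative vanishes because `d` is both the derivative of the integral and its
    -- image under `A`. The values at `ρ = s` and `ρ = u` are `0` and the integral up to `u`.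
    have := constant_of_has_deriv_right_zero hcont.continuousOn (a := s) (b := u) (fun ρ hρ => by
      have := hA.hasDerivWithinAt_semigroup_apply hT hJ hρ.2 (hder ρ).hasDerivWithinAt (hg ρ hρ.1)
      simpa using this) u ⟨hu, le_rfl⟩
    simpa [hT.zero] using this
  have h1 := hg t hst
  rw [hD t hst] at h1
  exact A.graph_fst_eq_zero_snd h1 rfl

end Duhamel

/-! ### Algebra of mild solutions and their equivalence with Duhamel's formula. -/

section Solutions

set_option linter.unusedSectionVars false

variable {𝕜 X : Type*} [RCLike 𝕜] [NormedAddCommGroup X] [NormedSpace 𝕜 X] [NormedSpace ℝ X]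
  [IsScalarTower ℝ 𝕜 X] {A : X →ₗ.[𝕜] X} {B : ℝ → X →L[𝕜] X}

theorem intervalIntegrable_of_continuousOn_Ici {E : Type*} [NormedAddCommGroup E] {y : ℝ → E}
    {s a b : ℝ} (hy : ContinuousOn y (Ici s)) (ha : s ≤ a) (hb : s ≤ b) :
    IntervalIntegrable y MeasureTheory.volume a b :=
  (hy.mono fun _ hr => (le_min ha hb).trans hr.1).intervalIntegrable

theorem IsSolution.continuousOn_coeff {s : ℝ} {y : ℝ → X} (hB : Continuous B)
    (hy : IsSolution A B s y) : ContinuousOn (fun r => B r (y r)) (Ici s) :=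
  hB.continuousOn.clm_apply hy.1

theorem IsSolution.congr {s : ℝ} {y z : ℝ → X} (hy : IsSolution A B s y)
    (h : EqOn z y (Ici s)) : IsSolution A B s z := by
  refine ⟨hy.1.congr h, fun t ht => ?_⟩
  have hsub : ∀ r ∈ uIcc s t, z r = y r := fun r hr => by
    rw [uIcc_of_le ht] at hr; exact h hr.1
  rw [h ht, h self_mem_Ici, intervalIntegral.integral_congr hsub,
    intervalIntegral.integral_congr (f := fun r => B r (z r)) (g := fun r => B r (y r))
      fun r hr => by simp only [hsub r hr]]
  exact hy.2 t ht

theorem IsSolution.add {s : ℝ} {y z : ℝ → X} (hB : Continuous B) (hy : IsSolution A B s y)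
    (hz : IsSolution A B s z) : IsSolution A B s fun t => y t + z t := by
  refine ⟨hy.1.add hz.1, fun t ht => ?_⟩
  have := A.graph.add_mem (hy.2 t ht) (hz.2 t ht)
  simp only [map_add]
  rw [intervalIntegral.integral_add (intervalIntegrable_of_continuousOn_Ici hy.1 le_rfl ht)
    (intervalIntegrable_of_continuousOn_Ici hz.1 le_rfl ht), intervalIntegral.integral_add
    (intervalIntegrable_of_continuousOn_Ici (hy.continuousOn_coeff hB) le_rfl ht)
    (intervalIntegrable_of_continuousOn_Ici (hz.continuousOn_coeff hB) le_rfl ht)]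
  convert this using 1
  ext
  · rfl
  · simp only [Prod.mk_add_mk]; abel

theorem IsSolution.const_smul {s : ℝ} {y : ℝ → X} (c : 𝕜) (hy : IsSolution A B s y) :
    IsSolution A B s fun t => c • y t := by
  refine ⟨hy.1.const_smul c, fun t ht => ?_⟩
  have := A.graph.smul_mem c (hy.2 t ht)
  simp only [map_smul]
  rw [intervalIntegral.integral_smul, intervalIntegral.integral_smul]
  convert this using 1
  simp only [Prod.smul_mk, smul_sub]

theorem IsSolution.sub {s : ℝ} {y z : ℝ → X} (hB : Continuous B) (hy : IsSolution A B s y)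
    (hz : IsSolution A B s z) : IsSolution A B s fun t => y t - z t := by
  simpa [sub_eq_add_neg] using hy.add hB (hz.const_smul (-1 : 𝕜))

theorem IsSolution.mem_graph {s a t : ℝ} {y : ℝ → X} (hB : Continuous B)
    (hy : IsSolution A B s y) (ha : s ≤ a) (ht : a ≤ t) :
    (∫ r in a..t, y r, y t - y a - ∫ r in a..t, B r (y r)) ∈ A.graph := by
  have := A.graph.sub_mem (hy.2 t (ha.trans ht)) (hy.2 a ha)
  have hy' := hy.continuousOn_coeff hB
  rw [Prod.mk_sub_mk, intervalIntegral.integral_interval_sub_left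
    (intervalIntegrable_of_continuousOn_Ici hy.1 le_rfl (ha.trans ht))
    (intervalIntegrable_of_continuousOn_Ici hy.1 le_rfl ha)] at this
  rw [← intervalIntegral.integral_interval_sub_left
    (intervalIntegrable_of_continuousOn_Ici hy' le_rfl (ha.trans ht))
    (intervalIntegrable_of_continuousOn_Ici hy' le_rfl ha)]
  convert this using 2
  abel

theorem IsSolution.mono {s a : ℝ} {y : ℝ → X} (hB : Continuous B)
    (hy : IsSolution A B s y) (ha : s ≤ a) : IsSolution A B a y :=
  ⟨hy.1.mono (Ici_subset_Ici.2 ha), fun _ ht => hy.mem_graph hB ha ht⟩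

/-- A solution may be modified before its initial time so as to become continuous on `ℝ`. -/
theorem IsSolution.clamp {s : ℝ} {y : ℝ → X} (hy : IsSolution A B s y) :
    IsSolution A B s (fun t => y (max t s)) ∧ Continuous fun t => y (max t s) :=
  ⟨hy.congr fun t ht => by simp only [max_eq_left (mem_Ici.1 ht)],
    hy.1.comp_continuous (by fun_prop) fun t => le_max_right t s⟩

/-- Both sides satisfy the integrated equation with the same forcing `B y` and the same initial
value, so their difference solves the homogeneous one. -/
theorem IsSolution.eq_duhamel [CompleteSpace X] {T : ℝ → X →L[𝕜] X} (hT : IsC0Semigroup T)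
    (hJ : Continuous fun p : ℝ × X => T (max p.1 0) p.2) (hA : IsGenerator A T)
    (hB : Continuous B) {s t : ℝ} {y : ℝ → X} (hy : IsSolution A B s y) (hyc : Continuous y)
    (ht : s ≤ t) : y t = duhamel T s (y s) (fun r => B r (y r)) t := by
  have hf : Continuous fun r => B r (y r) := hB.clm_apply hyc
  have hw := continuous_duhamel hJ hf s (y s)
  refine sub_eq_zero.1 (eq_zero_of_integral_mem_graph hT hJ hA
    (d := fun u => y u - duhamel T s (y s) (fun r => B r (y r)) u) (hyc.sub hw) (s := s)
    (fun u hu => ?_) ht)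
  have := A.graph.sub_mem (hy.2 u hu) (duhamel_mem_graph hT hJ hA hf (y s) hu)
  rw [Prod.mk_sub_mk, ← intervalIntegral.integral_sub (hyc.intervalIntegrable _ _)
    (hw.intervalIntegrable _ _)] at this
  convert this using 2
  abel

theorem isSolution_of_eq_duhamel [CompleteSpace X] {T : ℝ → X →L[𝕜] X} (hT : IsC0Semigroup T)
    (hJ : Continuous fun p : ℝ × X => T (max p.1 0) p.2) (hA : IsGenerator A T)
    (hB : Continuous B) {s : ℝ} {x : X} {y : ℝ → X} (hyc : Continuous y)
    (hy : ∀ t, s ≤ t → y t = duhamel T s x (fun r => B r (y r)) t) : IsSolution A B s y := by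
  refine ⟨hyc.continuousOn, fun t ht => ?_⟩
  have := duhamel_mem_graph hT hJ hA (hB.clm_apply hyc) x ht
  rw [← hy t ht] at this
  rw [hy s le_rfl, duhamel_self hT]
  convert this using 2
  refine intervalIntegral.integral_congr fun r hr => ?_
  rw [uIcc_of_le ht] at hr
  exact hy r hr.1

theorem IsRightProduct.apply_of_mem_graph {C E : X →L[𝕜] X} (hE : IsRightProduct A C E) {u v : X}
    (h : (u, v) ∈ A.graph) : C v = E u := by
  obtain ⟨z, rfl, rfl⟩ := (A.mem_graph_iff).1 h
  exact (hE z).symm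

/-- A product `C(t) y(t)` is differentiable along a mild solution `y` as soon as `C(r) A` is
bounded. -/
theorem IsSolution.hasDerivWithinAt_apply [CompleteSpace X] (hB : Continuous B) {s r : ℝ}
    {y : ℝ → X} (hy : IsSolution A B s y) (hyc : Continuous y) (hr : s ≤ r)
    {C : ℝ → X →L[𝕜] X} {C' E : X →L[𝕜] X} (hC : HasDerivAt C C' r)
    (hE : IsRightProduct A (C r) E) :
    HasDerivWithinAt (fun ρ => C ρ (y ρ)) (C' (y r) + (E (y r) + C r (B r (y r)))) (Ici r) r := by
  have hf : Continuous fun r => B r (y r) := hB.clm_apply hyc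
  -- Here `y` may fail to be differentiable. The increment of `C` needs only continuity of `y`; for
  -- the frozen `C r`, the integrated equation is used, with `E` absorbing the unbounded `A`.
  have h1 : HasDerivWithinAt (fun ρ => (C ρ - C r) (y ρ)) (C' (y r)) (Ici r) r := by
    rw [← hasDerivWithinAt_Ioi_iff_Ici, hasDerivWithinAt_iff_tendsto_slope' self_notMem_Ioi]
    have hs := (hasDerivWithinAt_iff_tendsto_slope' self_notMem_Ioi).1
      (hC.hasDerivWithinAt (s := Ioi r))
    have hy' : Tendsto y (𝓝[>] r) (𝓝 (y r)) := (hyc.tendsto r).mono_left nhdsWithin_le_nhds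
    refine ((isBoundedBilinearMap_apply (𝕜 := 𝕜) (E := X) (F := X)).continuous.tendsto
      (C', y r) |>.comp (hs.prodMk_nhds hy')).congr fun ρ => ?_
    simp [slope_def_module]
  have h2 : HasDerivWithinAt (fun ρ => C r (y ρ)) (E (y r) + C r (B r (y r))) (Ici r) r := by
    have e1 := (hyc.integral_hasStrictDerivAt r r).hasDerivAt
    have e2 := (hf.integral_hasStrictDerivAt r r).hasDerivAt
    have e3 := (((E.restrictScalars ℝ).hasFDerivAt.comp_hasDerivAt r e1).add
      (((C r).restrictScalars ℝ).hasFDerivAt.comp_hasDerivAt r e2)).const_add (C r (y r))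
    refine (e3.hasDerivWithinAt (s := Ici r)).congr (fun ρ hρ => ?_) (by simp)
    have := hE.apply_of_mem_graph (hy.mem_graph hB hr hρ)
    simp only [Pi.add_apply, Function.comp_apply, ContinuousLinearMap.coe_restrictScalars',
      ← this, map_sub]
    abel
  have h3 := h1.add h2
  refine h3.congr (fun ρ _ => ?_) ?_ <;> simp

end Solutions

/-! ### Integration by parts against the primitive of `B`. -/

section Estimate

variable {𝕜 X : Type*} [RCLike 𝕜] [NormedAddCommGroup X] [NormedSpace 𝕜 X] [NormedSpace ℝ X]
  [IsScalarTower ℝ 𝕜 X] [CompleteSpace X] {A : X →ₗ.[𝕜] X} {T B : ℝ → X →L[𝕜] X}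

theorem hasDerivAt_primitive (hB : Continuous B) (t u : ℝ) :
    HasDerivAt (primitive B t) (B u) u :=
  (hB.integral_hasStrictDerivAt t u).hasDerivAt

/-- The right derivative of `ρ ↦ T(t - ρ) (I - C_t(ρ)) y(ρ)` along a solution `y`. -/
theorem IsSolution.hasDerivWithinAt_semigroup_apply (hT : IsC0Semigroup T)
    (hJ : Continuous fun p : ℝ × X => T (max p.1 0) p.2) (hA : IsGenerator A T)
    (hB : Continuous B) {s r t : ℝ} {y : ℝ → X} (hy : IsSolution A B s y) (hyc : Continuous y)
    (hsr : s ≤ r) (hrt : r < t) {D E : X →L[𝕜] X}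
    (hD : IsLeftProduct A (primitive B t r) D) (hE : IsRightProduct A (primitive B t r) E) :
    HasDerivWithinAt (fun ρ => T (max (t - ρ) 0) (y ρ - primitive B t ρ (y ρ)))
      (T (max (t - r) 0) (D (y r) - E (y r) - primitive B t r (B r (y r)))) (Ici r) r := by
  have hf : Continuous fun r => B r (y r) := hB.clm_apply hyc
  have h1 : HasDerivWithinAt (fun ρ => T (max (t - ρ) 0) (y ρ))
      (T (max (t - r) 0) (B r (y r))) (Ici r) r := by
    have hc : Continuous fun σ => T (max (t - σ) 0) (B σ (y σ)) :=
      (continuous_convolution hJ hf).comp (continuous_const.prodMk continuous_id)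
    have hd := ((hc.integral_hasStrictDerivAt s r).hasDerivAt.const_add
      (T (max (t - s) 0) (y s))).hasDerivWithinAt (s := Ici r)
    have key : ∀ ρ ∈ Icc r t, T (max (t - ρ) 0) (y ρ)
        = T (max (t - s) 0) (y s) + ∫ σ in s..ρ, T (max (t - σ) 0) (B σ (y σ)) := by
      intro ρ hρ
      have hsρ := hsr.trans hρ.1
      have := semigroup_apply_duhamel hT hJ hf (y s) hsρ (sub_nonneg.2 hρ.2)
      rw [← hy.eq_duhamel hT hJ hA hB hyc hsρ] at this
      rw [max_eq_left (sub_nonneg.2 hρ.2), this, add_sub_cancel]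
    refine hd.congr_of_eventuallyEq ?_ (key r ⟨le_rfl, hrt.le⟩)
    filter_upwards [Icc_mem_nhdsGE hrt] with ρ hρ using key ρ hρ
  -- Unlike `y r`, the vector `C_t(r) y(r)` lies in `D(A)`. The derivative of `C_t` contributes `B r
  -- (y r)`, which cancels the term from `h1`.
  have h2 := hA.hasDerivWithinAt_semigroup_apply hT hJ hrt
    (hy.hasDerivWithinAt_apply hB hyc hsr (hasDerivAt_primitive hB t r) hE) (hD (y r))
  refine (h1.sub h2).congr_deriv ?_ |>.congr (fun ρ _ => ?_) ?_
  · rw [← map_sub]; congr 1; abel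
  · exact map_sub _ _ _
  · exact map_sub _ _ _

/-- The integral inequality obtained by integrating Duhamel's formula by parts. -/
theorem IsSolution.norm_le_integral (hT : IsC0Semigroup T)
    (hJ : Continuous fun p : ℝ × X => T (max p.1 0) p.2) (hA : IsGenerator A T) {K α : ℝ}
    (hK : 0 ≤ K) (hTK : ∀ t, 0 ≤ t → ‖T t‖ ≤ K * Real.exp (α * t))
    (hB : Continuous B) {M δ s t : ℝ} (hst : s ≤ t)
    (hC : ‖primitive B t s‖ ≤ δ)
    (hCB : ∀ r ∈ Icc s t, ‖(primitive B t r).comp (B r)‖ ≤ M * δ)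
    (hCA : ∀ r ∈ Icc s t, ∃ E : X →L[𝕜] X, IsRightProduct A (primitive B t r) E ∧ ‖E‖ ≤ M * δ)
    (hAC : ∀ r ∈ Icc s t, ∃ D : X →L[𝕜] X, IsLeftProduct A (primitive B t r) D ∧ ‖D‖ ≤ M * δ)
    {y : ℝ → X} (hy : IsSolution A B s y) (hyc : Continuous y) :
    ‖y t‖ ≤ (1 + δ) * K * Real.exp (α * (t - s)) * ‖y s‖
      + ∫ r in s..t, 3 * M * K * δ * (Real.exp (α * (t - r)) * ‖y r‖) := by
  choose! E hE hEn using hCA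
  choose! D hD hDn using hAC
  have hb : Continuous fun r => 3 * M * K * δ * (Real.exp (α * (t - r)) * ‖y r‖) := by fun_prop
  have hPc : Continuous fun ρ => primitive B t ρ (y ρ) :=
    (continuous_iff_continuousAt.2 fun ρ => (hasDerivAt_primitive hB t ρ).continuousAt).clm_apply hyc
  have hφ : Continuous fun ρ => T (max (t - ρ) 0) (y ρ - primitive B t ρ (y ρ)) :=
    hJ.comp ((continuous_const.sub continuous_id).prodMk (hyc.sub hPc))
  have hexp : ∀ r ≤ t, ‖T (max (t - r) 0)‖ ≤ K * Real.exp (α * (t - r)) := fun r hr => by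
    rw [max_eq_left (sub_nonneg.2 hr)]; exact hTK _ (sub_nonneg.2 hr)
  have main := image_norm_le_of_norm_deriv_right_le_deriv_boundary (a := s) (b := t)
    hφ.continuousOn
    (fun r hr => hy.hasDerivWithinAt_semigroup_apply hT hJ hA hB hyc hr.1 hr.2
      (hD r ⟨hr.1, hr.2.le⟩) (hE r ⟨hr.1, hr.2.le⟩))
    (B := fun u => (1 + δ) * K * Real.exp (α * (t - s)) * ‖y s‖
      + ∫ r in s..u, 3 * M * K * δ * (Real.exp (α * (t - r)) * ‖y r‖))
    (B' := fun r => 3 * M * K * δ * (Real.exp (α * (t - r)) * ‖y r‖))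
    (by
      rw [intervalIntegral.integral_same, add_zero]
      refine ((T _).le_of_opNorm_le (hexp s hst) _).trans ?_
      have : ‖y s - primitive B t s (y s)‖ ≤ (1 + δ) * ‖y s‖ := by
        rw [add_mul, one_mul]
        exact (norm_sub_le _ _).trans (add_le_add le_rfl ((primitive B t s).le_of_opNorm_le hC _))
      calc K * Real.exp (α * (t - s)) * ‖y s - primitive B t s (y s)‖
          ≤ K * Real.exp (α * (t - s)) * ((1 + δ) * ‖y s‖) := by gcongr
        _ = _ := by ring)
    (fun r => (hb.integral_hasStrictDerivAt s r).hasDerivAt.const_add _)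
    (fun r hr => by
      have hr' : r ∈ Icc s t := ⟨hr.1, hr.2.le⟩
      refine ((T _).le_of_opNorm_le (hexp r hr'.2) _).trans ?_
      have : ‖D r (y r) - E r (y r) - primitive B t r (B r (y r))‖ ≤ 3 * (M * δ * ‖y r‖) := by
        have h1 := (D r).le_of_opNorm_le (hDn r hr') (y r)
        have h2 := (E r).le_of_opNorm_le (hEn r hr') (y r)
        have h3 := ((primitive B t r).comp (B r)).le_of_opNorm_le (hCB r hr') (y r)
        have h4 := norm_sub_le (D r (y r) - E r (y r)) (primitive B t r (B r (y r)))
        have h5 := norm_sub_le (D r (y r)) (E r (y r))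
        rw [ContinuousLinearMap.comp_apply] at h3
        linarith
      calc K * Real.exp (α * (t - r)) * ‖D r (y r) - E r (y r) - primitive B t r (B r (y r))‖
          ≤ K * Real.exp (α * (t - r)) * (3 * (M * δ * ‖y r‖)) := by gcongr
        _ = _ := by ring)
    (x := t) ⟨hst, le_rfl⟩
  -- At `ρ = t` the primitive based at `t` vanishes and `T 0` is the identity, so the bounded
  -- quantity is `y t` itself.
  simpa [hT.zero, primitive] using main

end Estimate

/-! ### From one time step to exponential growth. -/

section Growth

variable {𝕜 X : Type*} [RCLike 𝕜] [NormedAddCommGroup X] [NormedSpace 𝕜 X] [NormedSpace ℝ X]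
  [IsScalarTower ℝ 𝕜 X] {A : X →ₗ.[𝕜] X} {T B : ℝ → X →L[𝕜] X}

/-- The growth estimate for solutions over one time step. -/
theorem IsSolution.norm_le_of_sub_le [CompleteSpace X] (hT : IsC0Semigroup T)
    (hA : IsGenerator A T) {K α : ℝ} (hK : 0 ≤ K) (hTK : ∀ t, 0 ≤ t → ‖T t‖ ≤ K * Real.exp (α * t))
    (hB : Continuous B) {h M δ : ℝ} (hM : 0 ≤ M) (hδ : 0 ≤ δ)
    (hC : ∀ t u, |u - t| ≤ h → ‖primitive B t u‖ ≤ δ)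
    (hCB : ∀ t u, |u - t| ≤ h → ‖(primitive B t u).comp (B u)‖ ≤ M * δ)
    (hCA : ∀ t u, |u - t| ≤ h →
      ∃ E : X →L[𝕜] X, IsRightProduct A (primitive B t u) E ∧ ‖E‖ ≤ M * δ)
    (hAC : ∀ t u, |u - t| ≤ h →
      ∃ D : X →L[𝕜] X, IsLeftProduct A (primitive B t u) D ∧ ‖D‖ ≤ M * δ)
    {s t : ℝ} {y : ℝ → X} (hy : IsSolution A B s y) (hst : s ≤ t) (hth : t - s ≤ h) :
    ‖y t‖ ≤ (1 + δ) * K * Real.exp ((α + 3 * M * K * δ) * (t - s)) * ‖y s‖ := by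
  wlog hyc : Continuous y generalizing y
  · simpa [hst] using this hy.clamp.1 hy.clamp.2
  have hJ := hT.continuous_action hK hTK
  -- The weight `e^{-α(r-s)}` turns the convolution kernel into a constant. Each `u` in `[s, t]`
  -- serves as a final time, so the base point of the primitive moves with `u`.
  have key := le_mul_exp_of_le_add_mul_integral (v := fun r => Real.exp (-α * (r - s)) * ‖y r‖)
    (a := (1 + δ) * K * ‖y s‖) (c := 3 * M * K * δ) (s := s) (t := t) (by fun_prop)
    (fun r => by positivity) (by positivity) (by positivity) hst (fun u hu => by
      have habs : ∀ r ∈ Icc s u, |r - u| ≤ h := fun r hr => by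
        rw [abs_sub_comm, abs_of_nonneg (sub_nonneg.2 hr.2)]; linarith [hr.1, hu.2]
      have h1 := hy.norm_le_integral hT hJ hA hK hTK hB hu.1 (hC u s (habs s ⟨le_rfl, hu.1⟩))
        (fun r hr => hCB u r (habs r hr)) (fun r hr => hCA u r (habs r hr))
        (fun r hr => hAC u r (habs r hr)) hyc
      have h2 := mul_le_mul_of_nonneg_left h1 (Real.exp_pos (-α * (u - s))).le
      refine h2.trans (le_of_eq ?_)
      rw [mul_add, ← intervalIntegral.integral_const_mul, ← intervalIntegral.integral_const_mul]
      congr 1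
      · have : Real.exp (-α * (u - s)) * Real.exp (α * (u - s)) = 1 := by
          rw [← Real.exp_add]; simp
        linear_combination (1 + δ) * K * ‖y s‖ * this
      · refine intervalIntegral.integral_congr fun r _ => ?_
        have : Real.exp (-α * (u - s)) * Real.exp (α * (u - r)) = Real.exp (-α * (r - s)) := by
          rw [← Real.exp_add]; congr 1; ring
        simp only [← this]; ring)
  have h3 := mul_le_mul_of_nonneg_left key (Real.exp_pos (α * (t - s))).le
  have e1 : Real.exp (α * (t - s)) * (Real.exp (-α * (t - s)) * ‖y t‖) = ‖y t‖ := by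
    rw [← mul_assoc, ← Real.exp_add]; simp
  have e2 : Real.exp ((α + 3 * M * K * δ) * (t - s))
      = Real.exp (α * (t - s)) * Real.exp (3 * M * K * δ * (t - s)) := by
    rw [← Real.exp_add]; congr 1; ring
  rw [e2]
  refine (e1.symm.le.trans h3).trans (le_of_eq (by ring))

/-- A one-step growth estimate that holds from every starting time yields exponential growth. -/
theorem IsSolution.norm_le_of_step (hB : Continuous B) {L γ h : ℝ} (hL : 1 ≤ L) (hh : 0 < h)
    {s : ℝ} {y : ℝ → X} (hy : IsSolution A B s y)
    (hstep : ∀ a t, s ≤ a → a ≤ t → t - a ≤ h → IsSolution A B a y →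
      ‖y t‖ ≤ L * Real.exp (γ * (t - a)) * ‖y a‖)
    {t : ℝ} (hst : s ≤ t) :
    ‖y t‖ ≤ L * Real.exp ((γ + Real.log L / h) * (t - s)) * ‖y s‖ := by
  have hL0 : 0 < L := one_pos.trans_le hL
  have hind : ∀ (n : ℕ) (t : ℝ), s ≤ t → t - s ≤ (n + 1) * h →
      ‖y t‖ ≤ L ^ (n + 1) * Real.exp (γ * (t - s)) * ‖y s‖ := by
    intro n
    induction n with
    | zero => intro t ht htn; simpa using hstep s t le_rfl ht (by simpa using htn) hy
    | succ n ih =>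
      intro t ht htn
      -- The last step has length at most `h`; the maximum keeps its start from preceding `s`.
      have ha : s ≤ max s (t - h) := le_max_left _ _
      have hat : max s (t - h) ≤ t := max_le ht (by linarith)
      have h1 := hstep _ t ha hat (by linarith [le_max_right s (t - h)]) (hy.mono hB ha)
      have h2 := ih (max s (t - h)) ha (by
        rw [sub_le_iff_le_add]
        push_cast at htn
        refine max_le (by nlinarith [(Nat.cast_nonneg n : (0 : ℝ) ≤ n)]) (by linarith))
      refine h1.trans ((mul_le_mul_of_nonneg_left h2 (by positivity)).trans (le_of_eq ?_))
      have : Real.exp (γ * (t - s)) = Real.exp (γ * (t - max s (t - h)))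
          * Real.exp (γ * (max s (t - h) - s)) := by
        rw [← Real.exp_add]; congr 1; ring
      rw [this]; ring
  have hts : 0 ≤ (t - s) / h := div_nonneg (sub_nonneg.2 hst) hh.le
  -- One of the `⌊(t - s) / h⌋₊ + 1` factors `L` stays as the prefactor; the others go into the
  -- exponential, which needs `1 ≤ L`.
  have h1 := hind ⌊(t - s) / h⌋₊ t hst ((div_le_iff₀ hh).1 (Nat.lt_floor_add_one _).le)
  have h2 : L ^ ⌊(t - s) / h⌋₊ ≤ Real.exp (Real.log L / h * (t - s)) := by
    rw [← Real.exp_log hL0, ← Real.exp_nat_mul, Real.exp_log hL0, Real.exp_le_exp]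
    calc (⌊(t - s) / h⌋₊ : ℝ) * Real.log L ≤ (t - s) / h * Real.log L :=
          mul_le_mul_of_nonneg_right (Nat.floor_le hts) (Real.log_nonneg hL)
      _ = _ := by ring
  refine h1.trans (mul_le_mul_of_nonneg_right ?_ (norm_nonneg _))
  calc L ^ (⌊(t - s) / h⌋₊ + 1) * Real.exp (γ * (t - s))
      = L * (Real.exp (γ * (t - s)) * L ^ ⌊(t - s) / h⌋₊) := by ring
    _ ≤ L * (Real.exp (γ * (t - s)) * Real.exp (Real.log L / h * (t - s))) := by gcongr
    _ = _ := by rw [← Real.exp_add]; congr 2; ring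

end Growth

/-! ### Existence by the Dyson series. -/

section Existence

variable {𝕜 X : Type*} [RCLike 𝕜] [NormedAddCommGroup X] [NormedSpace 𝕜 X] [NormedSpace ℝ X]
  {T B : ℝ → X →L[𝕜] X}

/-- The terms of the Dyson series of `y' = A y + B(t) y`, `y(s) = x`, frozen before time `s`. -/
def dysonTerm (T B : ℝ → X →L[𝕜] X) (s : ℝ) (x : X) : ℕ → ℝ → X
  | 0, t => T (max (t - s) 0) x
  | n + 1, t => ∫ r in s..max t s, T (max (max t s - r) 0) (B r (dysonTerm T B s x n r))

theorem continuous_dysonTerm (hJ : Continuous fun p : ℝ × X => T (max p.1 0) p.2)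
    (hB : Continuous B) (s : ℝ) (x : X) (n : ℕ) : Continuous (dysonTerm T B s x n) := by
  induction n with
  | zero => exact hJ.comp ((continuous_id.sub continuous_const).prodMk continuous_const)
  | succ n ih =>
    have hc := continuous_convolution hJ (hB.clm_apply ih)
    have hm : Continuous fun p : ℝ × ℝ => (max p.1 s, p.2) := by fun_prop
    exact intervalIntegral.continuous_parametric_intervalIntegral_of_continuous
      (f := fun t r => T (max (max t s - r) 0) (B r (dysonTerm T B s x n r)))
      (hc.comp hm) (by fun_prop : Continuous fun t => max t s)

/-- Each iteration contributes a factor `κ b` and integrates `(r - s) ^ n`, which produces the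
factorial. -/
theorem norm_dysonTerm_le {s N κ b : ℝ} (hκ : ∀ τ ≤ N - s, ‖T (max τ 0)‖ ≤ κ)
    (hb : ∀ r ∈ Icc s N, ‖B r‖ ≤ b) (hsN : s ≤ N) (x : X) (n : ℕ) {t : ℝ} (ht : t ≤ N) :
    ‖dysonTerm T B s x n t‖ ≤ κ * ‖x‖ * ((κ * b * (max t s - s)) ^ n / n.factorial) := by
  have hκ0 : 0 ≤ κ := (norm_nonneg _).trans (hκ (N - s) le_rfl)
  induction n generalizing t with
  | zero => simpa [dysonTerm] using (T _).le_of_opNorm_le (hκ (t - s) (by linarith)) x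
  | succ n ih =>
    have hsu : s ≤ max t s := le_max_right _ _
    have huN : max t s ≤ N := max_le ht hsN
    generalize hu : max t s = u at hsu huN
    have hbd : ∀ r ∈ Ioc s u, ‖T (max (u - r) 0) (B r (dysonTerm T B s x n r))‖
        ≤ κ * ‖x‖ * (κ * b) ^ (n + 1) / n.factorial * (r - s) ^ n := by
      intro r hr
      have h1 := ih (hr.2.trans huN)
      rw [max_eq_left hr.1.le] at h1
      have h2 := (B r).le_of_opNorm_le (hb r ⟨hr.1.le, hr.2.trans huN⟩) (dysonTerm T B s x n r)
      have h3 := (T (max (u - r) 0)).le_of_opNorm_le (hκ (u - r) (by linarith [hr.1]))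
        (B r (dysonTerm T B s x n r))
      have hb0 : 0 ≤ b := (norm_nonneg _).trans (hb r ⟨hr.1.le, hr.2.trans huN⟩)
      calc _ ≤ κ * (b * (κ * ‖x‖ * ((κ * b * (r - s)) ^ n / n.factorial))) :=
            h3.trans (mul_le_mul_of_nonneg_left
              (h2.trans (mul_le_mul_of_nonneg_left h1 hb0)) hκ0)
        _ = _ := by rw [mul_pow]; ring
    have hint := intervalIntegral.norm_integral_le_of_norm_le
      (μ := MeasureTheory.volume) hsu (MeasureTheory.ae_of_all _ hbd) (by
        have : Continuous fun r : ℝ =>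
            κ * ‖x‖ * (κ * b) ^ (n + 1) / n.factorial * (r - s) ^ n := by fun_prop
        exact this.intervalIntegrable s u)
    rw [intervalIntegral.integral_const_mul,
      intervalIntegral.integral_comp_sub_right (fun r => r ^ n), integral_pow] at hint
    rw [dysonTerm, hu]
    refine hint.trans (le_of_eq ?_)
    rw [Nat.factorial_succ]
    rw [sub_self, zero_pow n.succ_ne_zero, sub_zero, mul_pow (κ * b)]
    push_cast
    field_simp

theorem exists_summable_bound_dysonTerm {K α : ℝ} (hK : 0 ≤ K)
    (hTK : ∀ t, 0 ≤ t → ‖T t‖ ≤ K * Real.exp (α * t)) (hB : Continuous B) {s N : ℝ} (hsN : s ≤ N)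
    (x : X) : ∃ u : ℕ → ℝ, Summable u ∧ ∀ n, ∀ t ≤ N, ‖dysonTerm T B s x n t‖ ≤ u n := by
  obtain ⟨b, hb⟩ := (isCompact_Icc (a := s) (b := N)).exists_bound_of_continuousOn hB.continuousOn
  have hb0 : 0 ≤ b := (norm_nonneg _).trans (hb s ⟨le_rfl, hsN⟩)
  have hκ : ∀ τ ≤ N - s, ‖T (max τ 0)‖ ≤ K * Real.exp (|α| * (N - s)) := fun τ hτ => by
    refine (hTK _ (le_max_right _ _)).trans (mul_le_mul_of_nonneg_left (Real.exp_le_exp.2 ?_) hK)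
    exact (mul_le_mul_of_nonneg_right (le_abs_self α) (le_max_right _ _)).trans
      (mul_le_mul_of_nonneg_left (max_le hτ (sub_nonneg.2 hsN)) (abs_nonneg α))
  generalize K * Real.exp (|α| * (N - s)) = κ at hκ
  have hκ0 : 0 ≤ κ := (norm_nonneg _).trans (hκ (N - s) le_rfl)
  refine ⟨fun n => κ * ‖x‖ * ((κ * b * (N - s)) ^ n / n.factorial),
    (Real.summable_pow_div_factorial _).mul_left _, fun n t ht => ?_⟩
  refine (norm_dysonTerm_le hκ hb hsN x n ht).trans ?_
  have h1 : max t s - s ≤ N - s := sub_le_sub_right (max_le ht hsN) s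
  have h0 : 0 ≤ max t s - s := sub_nonneg.2 (le_max_right t s)
  dsimp only
  gcongr

theorem continuous_tsum_dysonTerm [CompleteSpace X]
    (hJ : Continuous fun p : ℝ × X => T (max p.1 0) p.2) {K α : ℝ} (hK : 0 ≤ K)
    (hTK : ∀ t, 0 ≤ t → ‖T t‖ ≤ K * Real.exp (α * t)) (hB : Continuous B) (s : ℝ) (x : X) :
    Continuous fun t => ∑' n, dysonTerm T B s x n t := by
  refine continuous_iff_continuousAt.2 fun t => ?_
  obtain ⟨u, hu, hbd⟩ := exists_summable_bound_dysonTerm hK hTK hB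
    (s := s) (N := max t s + 1) (by linarith [le_max_right t s]) x
  exact (continuousOn_tsum (fun n => (continuous_dysonTerm hJ hB s x n).continuousOn) hu hbd
    (s := Iic (max t s + 1))).continuousAt (Iic_mem_nhds (by linarith [le_max_left t s]))

/-- Term `n + 1` is the Duhamel integral of term `n`; dominated convergence lets the sum pass under
the integral. -/
theorem tsum_dysonTerm_eq_duhamel [CompleteSpace X]
    (hJ : Continuous fun p : ℝ × X => T (max p.1 0) p.2) {K α : ℝ} (hK : 0 ≤ K)
    (hTK : ∀ t, 0 ≤ t → ‖T t‖ ≤ K * Real.exp (α * t)) (hB : Continuous B) {s t : ℝ} (x : X)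
    (hst : s ≤ t) :
    ∑' n, dysonTerm T B s x n t
      = duhamel T s x (fun r => B r (∑' n, dysonTerm T B s x n r)) t := by
  obtain ⟨u, hu, hbd⟩ := exists_summable_bound_dysonTerm hK hTK hB hst x
  have hsum : ∀ r ≤ t, Summable fun n => dysonTerm T B s x n r := fun r hr =>
    hu.of_norm_bounded fun n => hbd n r hr
  obtain ⟨b, hb⟩ := (isCompact_Icc (a := s) (b := t)).exists_bound_of_continuousOn hB.continuousOn
  have hb0 : 0 ≤ b := (norm_nonneg _).trans (hb s ⟨le_rfl, hst⟩)
  rw [(hsum t le_rfl).tsum_eq_zero_add, duhamel]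
  congr 1
  simp only [dysonTerm, max_eq_left hst]
  refine (intervalIntegral.hasSum_integral_of_dominated_convergence
    (fun n r => K * Real.exp (α * (t - r)) * (b * u n)) (fun n => ?_) (fun n => ?_) ?_ ?_ ?_).tsum_eq
  · exact ((continuous_convolution hJ (hB.clm_apply (continuous_dysonTerm hJ hB s x n))).comp
      (continuous_const.prodMk continuous_id)).aestronglyMeasurable
  · refine MeasureTheory.ae_of_all _ fun r hr => ?_
    rw [uIoc_of_le hst] at hr
    rw [max_eq_left (sub_nonneg.2 hr.2)]
    refine ((T _).le_of_opNorm_le (hTK _ (sub_nonneg.2 hr.2)) _).trans ?_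
    refine mul_le_mul_of_nonneg_left ?_ (by positivity)
    exact ((B r).le_of_opNorm_le (hb r ⟨hr.1.le, hr.2⟩) _).trans
      (mul_le_mul_of_nonneg_left (hbd n r hr.2) hb0)
  · exact MeasureTheory.ae_of_all _ fun r _ => (hu.mul_left b).mul_left _
  · simp only [tsum_mul_left]
    exact Continuous.intervalIntegrable (by fun_prop) _ _
  · refine MeasureTheory.ae_of_all _ fun r hr => ?_
    rw [uIoc_of_le hst] at hr
    exact (T _).hasSum ((B r).hasSum (hsum r hr.2).hasSum)

theorem exists_isSolution [IsScalarTower ℝ 𝕜 X] [CompleteSpace X] {A : X →ₗ.[𝕜] X}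
    (hT : IsC0Semigroup T) (hA : IsGenerator A T) {K α : ℝ} (hK : 0 ≤ K)
    (hTK : ∀ t, 0 ≤ t → ‖T t‖ ≤ K * Real.exp (α * t)) (hB : Continuous B) (s : ℝ) (x : X) :
    ∃ y, IsSolution A B s y ∧ y s = x := by
  have hJ := hT.continuous_action hK hTK
  refine ⟨_, isSolution_of_eq_duhamel hT hJ hA hB
    (continuous_tsum_dysonTerm hJ hK hTK hB s x) fun t ht =>
      tsum_dysonTerm_eq_duhamel hJ hK hTK hB x ht, ?_⟩
  rw [tsum_dysonTerm_eq_duhamel hJ hK hTK hB x le_rfl, duhamel_self hT]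

end Existence

/-! ### Assembling the evolution operator; strong continuity and stability. -/

section EvolutionOperator

variable {𝕜 X : Type*} [RCLike 𝕜] [NormedAddCommGroup X] [NormedSpace 𝕜 X]

/-- Strong continuity of an evolution family follows from continuity in the first time variable,
from continuity along the diagonal and from an exponential bound. -/
theorem continuousOn_of_tendsto_diagonal {S : ℝ → ℝ → X →L[𝕜] X} {L β : ℝ}
    (hcomp : ∀ s r t, s ≤ r → r ≤ t → (S t r).comp (S r s) = S t s)
    (hS : ∀ s t, s ≤ t → ‖S t s‖ ≤ L * Real.exp (β * (t - s))) (x : X)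
    (hfst : ∀ s, ContinuousOn (fun t => S t s x) (Ici s))
    (hdiag : ∀ s₀, Tendsto (fun p : ℝ × ℝ => S p.1 p.2 x) (𝓝[{p | p.2 ≤ p.1}] (s₀, s₀)) (𝓝 x))
    (hself : ∀ s, S s s x = x) :
    ContinuousOn (fun p : ℝ × ℝ => S p.1 p.2 x) {p | p.2 ≤ p.1} := by
  rintro ⟨t₀, s₀⟩ (h₀ : s₀ ≤ t₀)
  rcases h₀.eq_or_lt with rfl | hlt
  · simpa only [ContinuousWithinAt, hself] using hdiag s₀
  have h1 : Tendsto (fun p : ℝ × ℝ => S p.1 s₀ x) (𝓝[{p | p.2 ≤ p.1}] (t₀, s₀))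
      (𝓝 (S t₀ s₀ x)) := by
    have hc : ContinuousAt (fun t => S t s₀ x) t₀ := (hfst s₀).continuousAt (Ici_mem_nhds hlt)
    exact (hc.tendsto.comp (continuous_fst.tendsto (t₀, s₀))).mono_left nhdsWithin_le_nhds
  -- By the composition law, changing the initial time from `s₀` to `s` amounts to applying `S t
  -- (max s s₀)` to `S (max s s₀) (min s s₀) x - x`, up to sign, and this vector is controlled near
  -- the diagonal.
  have h2 : Tendsto (fun p : ℝ × ℝ => L * Real.exp (β * (p.1 - max p.2 s₀))
      * ‖S (max p.2 s₀) (min p.2 s₀) x - x‖) (𝓝[{p | p.2 ≤ p.1}] (t₀, s₀)) (𝓝 0) := by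
    have hm : Tendsto (fun p : ℝ × ℝ => (max p.2 s₀, min p.2 s₀)) (𝓝 (t₀, s₀))
        (𝓝[{p | p.2 ≤ p.1}] (s₀, s₀)) := by
      refine tendsto_nhdsWithin_iff.2 ⟨?_, Eventually.of_forall fun p => ?_⟩
      swap
      · exact (min_le_max : min p.2 s₀ ≤ max p.2 s₀)
      have : Continuous fun p : ℝ × ℝ => (max p.2 s₀, min p.2 s₀) := by fun_prop
      simpa using this.tendsto (t₀, s₀)
    have e1 := (((hdiag s₀).comp hm).sub_const x).norm
    have e2 : Continuous fun p : ℝ × ℝ => L * Real.exp (β * (p.1 - max p.2 s₀)) := by fun_prop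
    have := (e2.tendsto (t₀, s₀)).mul e1
    simp only [sub_self, norm_zero, mul_zero] at this
    exact this.mono_left nhdsWithin_le_nhds
  have h3 : Tendsto (fun p : ℝ × ℝ => S p.1 p.2 x - S p.1 s₀ x)
      (𝓝[{p | p.2 ≤ p.1}] (t₀, s₀)) (𝓝 0) := by
    refine squeeze_zero_norm' ?_ h2
    filter_upwards [self_mem_nhdsWithin, mem_nhdsWithin_of_mem_nhds
      (continuous_fst.tendsto (t₀, s₀) (Ioi_mem_nhds hlt))]
    rintro ⟨t, s⟩ (hst : s ≤ t) (hs₀t : s₀ < t)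
    dsimp only
    rcases le_total s s₀ with hs | hs
    · rw [max_eq_right hs, min_eq_left hs, ← hcomp s s₀ t hs hs₀t.le,
        ContinuousLinearMap.comp_apply, ← map_sub]
      exact (S t s₀).le_of_opNorm_le (hS s₀ t hs₀t.le) _
    · rw [max_eq_left hs, min_eq_right hs, ← hcomp s₀ s t hs hst,
        ContinuousLinearMap.comp_apply, ← map_sub, norm_sub_rev _ x]
      exact (S t s).le_of_opNorm_le (hS s t hst) _
  simpa [ContinuousWithinAt] using h3.add h1

variable [NormedSpace ℝ X] {A : X →ₗ.[𝕜] X} {T B : ℝ → X →L[𝕜] X}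

theorem asymptoticallyStable_of_growth {L β : ℝ} (hL : 0 < L) (hβ : β < 0)
    (hG : ∀ s y, IsSolution A B s y → ∀ t, s ≤ t →
      ‖y t‖ ≤ L * Real.exp (β * (t - s)) * ‖y s‖) : AsymptoticallyStable A B := by
  refine ⟨fun s ε hε => ⟨ε / L, div_pos hε hL, fun y hy hys t ht => ?_⟩, fun s y hy => ?_⟩
  · have h1 : Real.exp (β * (t - s)) ≤ 1 :=
      Real.exp_le_one_iff.2 (mul_nonpos_of_nonpos_of_nonneg hβ.le (sub_nonneg.2 ht))
    calc ‖y t‖ ≤ L * Real.exp (β * (t - s)) * ‖y s‖ := hG s y hy t ht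
      _ ≤ L * 1 * ‖y s‖ := by gcongr
      _ < L * 1 * (ε / L) := by gcongr
      _ = ε := by field_simp
  · have h1 : Tendsto (fun t => β * (t - s)) atTop atBot :=
      (tendsto_atTop_add_const_right _ (-s) tendsto_id).const_mul_atTop_of_neg hβ
    have h2 := ((Real.tendsto_exp_atBot.comp h1).const_mul L).mul_const ‖y s‖
    rw [mul_zero, zero_mul] at h2
    refine squeeze_zero_norm' ?_ h2
    filter_upwards [eventually_ge_atTop s] with t ht using hG s y hy t ht

variable [IsScalarTower ℝ 𝕜 X]

theorem IsSolution.eqOn_of_growth (hB : Continuous B) {L β : ℝ}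
    (hG : ∀ s y, IsSolution A B s y → ∀ t, s ≤ t →
      ‖y t‖ ≤ L * Real.exp (β * (t - s)) * ‖y s‖)
    {s : ℝ} {y z : ℝ → X} (hy : IsSolution A B s y) (hz : IsSolution A B s z) (h : y s = z s) :
    EqOn y z (Ici s) := fun t ht => by
  have := hG s _ (hy.sub hB hz) t ht
  rw [h, sub_self, norm_zero, mul_zero] at this
  exact sub_eq_zero.1 (norm_le_zero_iff.1 this)

/-- Solutions starting at `x` at time `s` tend to `x`, uniformly with respect to `s`. -/
theorem tendsto_solution_diagonal [CompleteSpace X] (hT : IsC0Semigroup T)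
    (hA : IsGenerator A T) {K α : ℝ} (hK : 0 ≤ K)
    (hTK : ∀ t, 0 ≤ t → ‖T t‖ ≤ K * Real.exp (α * t)) (hB : Continuous B) {L β : ℝ} (hL : 0 ≤ L)
    (hG : ∀ s y, IsSolution A B s y → ∀ t, s ≤ t →
      ‖y t‖ ≤ L * Real.exp (β * (t - s)) * ‖y s‖)
    {Y : ℝ → ℝ → X} {x : X} (hY : ∀ s, IsSolution A B s fun t => Y t s) (hYx : ∀ s, Y s s = x)
    (s₀ : ℝ) :
    Tendsto (fun p : ℝ × ℝ => Y p.1 p.2) (𝓝[{p | p.2 ≤ p.1}] (s₀, s₀)) (𝓝 x) := by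
  have hJ := hT.continuous_action hK hTK
  obtain ⟨b, hb⟩ := (isCompact_Icc (a := s₀ - 1) (b := s₀ + 1)).exists_bound_of_continuousOn
    hB.continuousOn
  have hb0 : 0 ≤ b := (norm_nonneg _).trans (hb s₀ ⟨by linarith, by linarith⟩)
  -- Both times lie within `1` of `s₀`, so elapsed times are at most `2`. The factors bound `T`, `B`
  -- and the solution in the Duhamel integrand.
  let c : ℝ := K * Real.exp (|α| * 2) * (b * (L * Real.exp (|β| * 2) * ‖x‖))
  have hlim : Tendsto (fun p : ℝ × ℝ => ‖T (max (p.1 - p.2) 0) x - x‖ + c * |p.1 - p.2|)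
      (𝓝[{p | p.2 ≤ p.1}] (s₀, s₀)) (𝓝 0) := by
    have h1 : Continuous fun p : ℝ × ℝ => T (max (p.1 - p.2) 0) x :=
      hJ.comp ((continuous_fst.sub continuous_snd).prodMk continuous_const)
    have h2 : Continuous fun p : ℝ × ℝ => ‖T (max (p.1 - p.2) 0) x - x‖ + c * |p.1 - p.2| :=
      (h1.sub continuous_const).norm.add
        (continuous_const.mul (continuous_fst.sub continuous_snd).abs)
    have := h2.tendsto (s₀, s₀)
    simp only [sub_self, max_self, hT.zero, ContinuousLinearMap.id_apply, norm_zero, abs_zero,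
      mul_zero, add_zero] at this
    exact this.mono_left nhdsWithin_le_nhds
  rw [tendsto_iff_norm_sub_tendsto_zero]
  refine squeeze_zero' (Eventually.of_forall fun _ => norm_nonneg _) ?_ hlim
  have hnhds : Icc (s₀ - 1) (s₀ + 1) ×ˢ Icc (s₀ - 1) (s₀ + 1) ∈ 𝓝 (s₀, s₀) :=
    prod_mem_nhds (Icc_mem_nhds (by linarith) (by linarith))
      (Icc_mem_nhds (by linarith) (by linarith))
  filter_upwards [self_mem_nhdsWithin, mem_nhdsWithin_of_mem_nhds hnhds]
  rintro ⟨t, s⟩ (hst : s ≤ t) ⟨ht, hs⟩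
  dsimp only at ht hs
  have hY' := (hY s).clamp
  have hd := hY'.1.eq_duhamel hT hJ hA hB hY'.2 hst
  simp only [max_eq_left hst, max_self, hYx, duhamel] at hd
  dsimp only
  rw [hd, add_sub_right_comm]
  refine (norm_add_le _ _).trans (add_le_add le_rfl ?_)
  refine intervalIntegral.norm_integral_le_of_norm_le_const fun r hr => ?_
  rw [uIoc_of_le hst] at hr
  rw [max_eq_left hr.1.le, max_eq_left (sub_nonneg.2 hr.2)]
  have hexp : ∀ (a : ℝ) {τ : ℝ}, 0 ≤ τ → τ ≤ 2 → Real.exp (a * τ) ≤ Real.exp (|a| * 2) :=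
    fun a τ h0 h2 => Real.exp_le_exp.2 ((mul_le_mul_of_nonneg_right (le_abs_self a) h0).trans
      (mul_le_mul_of_nonneg_left h2 (abs_nonneg a)))
  have e1 : ‖Y r s‖ ≤ L * Real.exp (|β| * 2) * ‖x‖ := by
    refine (hG s _ (hY s) r hr.1.le).trans ?_
    rw [hYx]
    gcongr L * ?_ * ‖x‖
    exact hexp β (by linarith [hr.1]) (by linarith [hr.2, ht.2, hs.1])
  have e2 := ((B r).le_of_opNorm_le (hb r ⟨by linarith [hr.1, hs.1], hr.2.trans ht.2⟩)
    (Y r s)).trans (mul_le_mul_of_nonneg_left e1 hb0)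
  refine ((T (t - r)).le_of_opNorm_le (hTK _ (sub_nonneg.2 hr.2)) _).trans ?_
  have e3 := hexp α (sub_nonneg.2 hr.2) (by linarith [hr.1, ht.2, hs.1])
  exact mul_le_mul (mul_le_mul_of_nonneg_left e3 hK) e2 (norm_nonneg _) (by positivity)

/-- If every initial value problem is solvable and solutions obey an exponential bound, then the
solution operators form an evolution operator. -/
theorem exists_isEvolutionOperator [CompleteSpace X] (hT : IsC0Semigroup T)
    (hA : IsGenerator A T) {K α : ℝ} (hK : 0 ≤ K)
    (hTK : ∀ t, 0 ≤ t → ‖T t‖ ≤ K * Real.exp (α * t)) (hB : Continuous B) {L β : ℝ} (hL : 0 ≤ L)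
    (hG : ∀ s y, IsSolution A B s y → ∀ t, s ≤ t →
      ‖y t‖ ≤ L * Real.exp (β * (t - s)) * ‖y s‖) :
    ∃ S : ℝ → ℝ → X →L[𝕜] X, IsEvolutionOperator A B S ∧
      ∀ s t, s ≤ t → ‖S t s‖ ≤ L * Real.exp (β * (t - s)) := by
  choose Y hY hY0 using exists_isSolution hT hA hK hTK hB
  -- Uniqueness makes the chosen solutions linear in the initial value. The value `0` for `t < s` is
  -- a dummy.
  let S : ℝ → ℝ → X →L[𝕜] X := fun t s => if hst : s ≤ t then
    LinearMap.mkContinuous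
      { toFun := fun x => Y s x t
        map_add' := fun x x' => (hY s (x + x')).eqOn_of_growth hB hG
          ((hY s x).add hB (hY s x')) (by simp only [hY0]) hst
        map_smul' := fun c x => (hY s (c • x)).eqOn_of_growth hB hG
          ((hY s x).const_smul c) (by simp only [hY0]) hst }
      (L * Real.exp (β * (t - s)))
      (fun x => by
        have := hG s _ (hY s x) t hst
        rwa [hY0] at this) else 0
  have hSY : ∀ s t, s ≤ t → ∀ x, S t s x = Y s x t := fun s t hst x => by
    simp only [S, dif_pos hst]; rfl
  have hSn : ∀ s t, s ≤ t → ‖S t s‖ ≤ L * Real.exp (β * (t - s)) := fun s t hst => by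
    simp only [S, dif_pos hst]
    exact LinearMap.mkContinuous_norm_le _ (by positivity) _
  have hSol : ∀ s x, IsSolution A B s fun t => S t s x := fun s x =>
    (hY s x).congr fun t ht => hSY s t ht x
  have hself : ∀ s x, S s s x = x := fun s x => by rw [hSY s s le_rfl, hY0]
  have hcomp : ∀ s r t, s ≤ r → r ≤ t → (S t r).comp (S r s) = S t s := fun s r t hsr hrt => by
    ext x
    exact (hSol r (S r s x)).eqOn_of_growth hB hG ((hSol s x).mono hB hsr) (hself r _) hrt
  refine ⟨S, ⟨fun s => by ext x; exact hself s x, hcomp, fun x => ?_, hSol⟩, hSn⟩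
  exact continuousOn_of_tendsto_diagonal hcomp hSn x (fun s => (hSol s x).1)
    (fun s₀ => tendsto_solution_diagonal hT hA hK hTK hB hL hG (fun s => hSol s x)
      (fun s => hself s x) s₀) (fun s => hself s x)

end EvolutionOperator

end EvolutionStability

end

/-! ### The main theorem. -/

open EvolutionStability
theorem mainTheorem3 {𝕜 X : Type*} [RCLike 𝕜] [NormedAddCommGroup X] [NormedSpace 𝕜 X]
    [NormedSpace ℝ X] [IsScalarTower ℝ 𝕜 X] [CompleteSpace X]
    (A : X →ₗ.[𝕜] X) (T : ℝ → X →L[𝕜] X) (hT : IsC0Semigroup T) (hA : IsGenerator A T)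
    (K α : ℝ) (hK : 1 ≤ K) (hTK : ∀ t, 0 ≤ t → ‖T t‖ ≤ K * Real.exp (α * t))
    (B : ℝ → X →L[𝕜] X) (hB : Continuous B)
    (hAB : ∀ t, ∃ D : X →L[𝕜] X, IsLeftProduct A (B t) D)
    (hBA : ∀ t, ∃ E : X →L[𝕜] X, IsRightProduct A (B t) E)
    (h M δ : ℝ) (hh : 0 < h) (hM : 0 < M) (hδ : 0 < δ)
    (hC : ∀ t u, |u - t| ≤ h → ‖primitive B t u‖ ≤ δ)
    (hCB : ∀ t u, |u - t| ≤ h → ‖(primitive B t u).comp (B u)‖ ≤ M * δ)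
    (hCA : ∀ t u, |u - t| ≤ h →
      ∃ E : X →L[𝕜] X, IsRightProduct A (primitive B t u) E ∧ ‖E‖ ≤ M * δ)
    (hAC : ∀ t u, |u - t| ≤ h →
      ∃ D : X →L[𝕜] X, IsLeftProduct A (primitive B t u) D ∧ ‖D‖ ≤ M * δ)
    (β : ℝ) (hβ : β = α + 3 * M * K * δ + Real.log ((1 + δ) * K) / h) :
    ∃ S : ℝ → ℝ → X →L[𝕜] X,
      IsEvolutionOperator A B S ∧
      (∀ S' : ℝ → ℝ → X →L[𝕜] X, IsEvolutionOperator A B S' →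
        ∀ s t, s ≤ t → S' t s = S t s) ∧
      (∀ s t, s ≤ t → ‖S t s‖ ≤ (1 + δ) * K * Real.exp (β * (t - s))) ∧
      (β < 0 → AsymptoticallyStable A B) := by
  have hK0 : 0 ≤ K := zero_le_one.trans hK
  have hL : 1 ≤ (1 + δ) * K := one_le_mul_of_one_le_of_one_le (by linarith) hK
  have hG : ∀ s y, IsSolution A B s y → ∀ t, s ≤ t →
      ‖y t‖ ≤ (1 + δ) * K * Real.exp (β * (t - s)) * ‖y s‖ := fun s y hy t hst => by
    rw [hβ]
    exact hy.norm_le_of_step hB hL hh (fun a u _ hau huh hya =>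
      hya.norm_le_of_sub_le hT hA hK0 hTK hB hM.le hδ.le hC hCB hCA hAC hau huh) hst
  obtain ⟨S, hS, hSn⟩ := exists_isEvolutionOperator hT hA hK0 hTK hB (zero_le_one.trans hL) hG
  refine ⟨S, hS, fun S' hS' s t hst => ?_, hSn, fun hneg =>
    asymptoticallyStable_of_growth (one_pos.trans_le hL) hneg hG⟩
  ext x
  exact (hS'.isSolution s x).eqOn_of_growth hB hG (hS.isSolution s x)
    (by simp only [hS.self, hS'.self]) hst
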